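/- Let $c_{00}$ be the space of finitely supported real sequences $x=(x(j))_{j\ge 1}$. For a finite set $E\subset\mathbb N=\{1,2,\dots\}$ let $Ex$ be the sequence that agrees with $x$ on $E$ and vanishes off $E$. For $k\in\mathbb N$ and nonempty finite sets $E_1,\dots,E_k\subset\mathbb N$ write $k\le E_1<\dots<E_k$ if $k\le\min E_1$ and $\max E_j<\min E_{j+1}$ for all $1\le j<k$. For $\theta\in(0,1)$ let $\|\cdot\|_{T_\theta}$ be the unique norm on $c_{00}$ such that, for every $x\in c_{00}$, $$\|x\|_{T_\theta}=\max\Big\{\|x\|_\infty,\ \theta\sup\Big\{\sum_{j=1}^k\|E_jx\|_{T_\theta}\colon k\in\mathbb N,\ k\le E_1<\dots<E_k\Big\}\Big\},$$ let $T_\theta$ be the completion of $(c_{00},\|\cdot\|_{T_\theta})$, and let $T^*_\theta$ (the original Tsirelson space) be the Banach space dual of $T_\theta$. For a normed space $X$ with closed unit ball $B_X$, let $K(X)$ be the supremum of all $\sigma\ge0$ for which there is a sequence $(x_n)_{n=1}^\infty$ in $B_X$ with $\|x_m-x_n\|\ge\sigma$ for all $m\ne n$, and let $K^s(X)$ be the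 supremum of all $\sigma\ge0$ for which there is a sequence $(x_n)_{n=1}^\infty$ in $B_X$ with $\|x_m-x_n\|\ge\sigma$ and $\|x_m+x_n\|\ge\sigma$ for all $m\neq n$. Theorem. For every $\theta\in(0,1)$, $$K(T^*_\theta)=K^s(T^*_\theta)=\begin{cases}2&\text{if }\theta\in(0,1/2],\\ 1/\theta&\text{if }\theta\in(1/2,1).\end{cases}$$ -/

import Mathlib

noncomputable section

/-! Separation constants of a normed space -/

/-- The Kottman constant `K(X)`: the supremum of all `σ ≥ 0` for which the closed unit ball of `X`
contains a `σ`-separated sequence. The set contains `0` and is bounded above by `2`. -/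
def kottmanConstant (X : Type*) [NormedAddCommGroup X] : ℝ :=
  sSup {σ : ℝ | 0 ≤ σ ∧ ∃ x : ℕ → X, (∀ n, ‖x n‖ ≤ 1) ∧
    ∀ m n, m ≠ n → σ ≤ ‖x m - x n‖}

/-- The symmetric Kottman constant `K^s(X)`: the supremum of all `σ ≥ 0` for which the closed unit
ball of `X` contains a symmetrically `σ`-separated sequence. -/
def symmetricKottmanConstant (X : Type*) [NormedAddCommGroup X] : ℝ :=
  sSup {σ : ℝ | 0 ≤ σ ∧ ∃ x : ℕ → X, (∀ n, ‖x n‖ ≤ 1) ∧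
    ∀ m n, m ≠ n → σ ≤ ‖x m - x n‖ ∧ σ ≤ ‖x m + x n‖}

namespace Tsirelson

/-- The space `c₀₀` of finitely supported real sequences indexed by `1, 2, 3, …`. -/
abbrev C00 : Type := ℕ+ →₀ ℝ

/-- The vector `E x`, which agrees with `x` on `E` and vanishes off `E`. -/
def restrict (E : Finset ℕ+) (x : C00) : C00 := x.filter (· ∈ E)

/-- `k ≤ E₁ < ⋯ < E_k`, for nonempty finite sets of positive integers. (The empty family, `k = 0`,
is admissible; it contributes only the sum `0` below.) -/
structure IsAdmissible {k : ℕ} (E : Fin k → Finset ℕ+) : Prop where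
  nonempty : ∀ i, (E i).Nonempty
  le : ∀ i, ∀ n ∈ E i, k ≤ (n : ℕ)
  lt : ∀ i j, i < j → ∀ m ∈ E i, ∀ n ∈ E j, m < n

/-- The set of all the sums `∑ j, N (E_j x)` over the families `k ≤ E₁ < ⋯ < E_k`. -/
def admissibleSums (N : C00 → ℝ) (x : C00) : Set ℝ :=
  {s | ∃ (k : ℕ) (E : Fin k → Finset ℕ+), IsAdmissible E ∧ s = ∑ j, N (restrict (E j) x)}

/-- The supremum norm on `c₀₀`. -/
def supNorm (x : C00) : ℝ := ⨆ n, |x n|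

/-- The implicit equation
`N x = max {‖x‖_∞, θ sup {∑ j, N (E_j x) : k ∈ ℕ, k ≤ E₁ < ⋯ < E_k}}`,
including that the supremum is finite. A seminorm `N` that satisfies it dominates the supremum
norm, and so is a norm. -/
def IsTsirelsonNorm (θ : ℝ) (N : Seminorm ℝ C00) : Prop :=
  ∀ x, ∃ s, IsLUB (admissibleSums N x) s ∧ N x = max (supNorm x) (θ * s)

/-! Existence and uniqueness of the norm -/

lemma restrict_apply (E : Finset ℕ+) (x : C00) (n : ℕ+) :
    restrict E x n = if n ∈ E then x n else 0 := by
  simp [restrict, Finsupp.filter_apply]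

lemma restrict_add (E : Finset ℕ+) (x y : C00) :
    restrict E (x + y) = restrict E x + restrict E y := by
  ext n; simp only [restrict_apply, Finsupp.add_apply]; split_ifs <;> simp

lemma restrict_smul (E : Finset ℕ+) (c : ℝ) (x : C00) :
    restrict E (c • x) = c • restrict E x := by
  ext n; simp [restrict_apply]

/-- The `ℓ₁` norm on `c₀₀`. -/
def l1 (x : C00) : ℝ := ∑ n ∈ x.support, |x n|

lemma abs_le_l1 (x : C00) (n : ℕ+) : |x n| ≤ l1 x := by
  by_cases hn : n ∈ x.support
  · exact Finset.single_le_sum (f := fun n => |x n|) (fun _ _ => abs_nonneg _) hn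
  · have h : x n = 0 := by simpa using hn
    rw [h, abs_zero]
    exact Finset.sum_nonneg fun n _ => abs_nonneg (x n)

lemma abs_le_supNorm (x : C00) (n : ℕ+) : |x n| ≤ supNorm x :=
  le_ciSup (f := fun n => |x n|) ⟨l1 x, by rintro _ ⟨n, rfl⟩; exact abs_le_l1 x n⟩ n

lemma support_restrict_subset (E : Finset ℕ+) (x : C00) :
    (restrict E x).support ⊆ x.support := by
  intro n hn
  simp only [Finsupp.mem_support_iff, restrict_apply] at hn ⊢
  intro h
  simp [h] at hn

lemma l1_restrict (E : Finset ℕ+) (x : C00) :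
    l1 (restrict E x) = ∑ n ∈ x.support, if n ∈ E then |x n| else 0 := by
  unfold l1
  rw [Finset.sum_subset (support_restrict_subset E x)]
  · refine Finset.sum_congr rfl fun n _ => ?_
    rw [restrict_apply]; split_ifs <;> simp
  · intro n _ hn
    simpa using hn

lemma sum_l1_le {k : ℕ} {E : Fin k → Finset ℕ+} (hE : IsAdmissible E) (x : C00) :
    ∑ j, l1 (restrict (E j) x) ≤ l1 x := by
  simp only [l1_restrict]
  rw [Finset.sum_comm]
  refine Finset.sum_le_sum fun n _ => ?_
  by_cases h : ∃ j, n ∈ E j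
  · obtain ⟨j, hj⟩ := h
    rw [Finset.sum_eq_single j]
    · simp [hj]
    · intro i _ hij
      rw [if_neg]
      intro hi
      rcases lt_or_gt_of_ne hij with h | h
      · exact lt_irrefl _ (hE.lt _ _ h _ hi _ hj)
      · exact lt_irrefl _ (hE.lt _ _ h _ hj _ hi)
    · simp
  · push Not at h
    simp [h]

/-- Functionals generated from the signed coordinates by `f₁, …, f_k ↦ θ (f₁ ∘ E₁ + ⋯ + f_k ∘ E_k)`
with `k ≤ E₁ < ⋯ < E_k`. They serve to construct the norm. -/
inductive Norming (θ : ℝ) : (C00 → ℝ) → Prop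
  | pos (n : ℕ+) : Norming θ fun x => x n
  | neg (n : ℕ+) : Norming θ fun x => -x n
  | comb {k : ℕ} (E : Fin k → Finset ℕ+) (hE : IsAdmissible E) (f : Fin k → C00 → ℝ)
      (hf : ∀ j, Norming θ (f j)) : Norming θ fun x => θ * ∑ j, f j (restrict (E j) x)

namespace Norming

variable {θ : ℝ} {f : C00 → ℝ}

lemma map_add (hf : Norming θ f) : ∀ x y, f (x + y) = f x + f y := by
  induction hf with
  | pos n => intro x y; simp
  | neg n => intro x y; simp; ring
  | comb E hE f hf ih =>
    intro x y
    simp only [restrict_add, ih, Finset.sum_add_distrib, mul_add]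

lemma map_smul (hf : Norming θ f) : ∀ (c : ℝ) x, f (c • x) = c * f x := by
  induction hf with
  | pos n => intro c x; simp
  | neg n => intro c x; simp
  | comb E hE f hf ih =>
    intro c x
    simp only [restrict_smul, ih, ← Finset.mul_sum]
    ring

lemma neg_mem (hf : Norming θ f) : Norming θ fun x => -f x := by
  induction hf with
  | pos n => exact .neg n
  | neg n => simpa using Norming.pos n
  | comb E hE f hf ih =>
    have := Norming.comb E hE _ ih
    simpa using this

lemma le_l1 (h0 : 0 < θ) (h1 : θ < 1) (hf : Norming θ f) : ∀ x, f x ≤ l1 x := by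
  induction hf with
  | pos n => intro x; exact (le_abs_self _).trans (abs_le_l1 x n)
  | neg n => intro x; exact (neg_le_abs _).trans (abs_le_l1 x n)
  | comb E hE f hf ih =>
    intro x
    have hx : 0 ≤ l1 x := (abs_nonneg _).trans (abs_le_l1 x 1)
    calc _ ≤ θ * l1 x := by
          refine mul_le_mul_of_nonneg_left ?_ h0.le
          exact (Finset.sum_le_sum fun j _ => ih j _).trans (sum_l1_le hE x)
      _ ≤ l1 x := by nlinarith

end Norming

/-- The supremum of the norming functionals. -/
def norming (θ : ℝ) (x : C00) : ℝ := ⨆ f : {f // Norming θ f}, f.1 x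

section

variable {θ : ℝ}

instance : Nonempty {f // Norming θ f} := ⟨⟨_, .pos 1⟩⟩

lemma le_norming (h0 : 0 < θ) (h1 : θ < 1) {f : C00 → ℝ} (hf : Norming θ f) (x : C00) :
    f x ≤ norming θ x := by
  refine le_ciSup (f := fun f : {f // Norming θ f} => f.1 x) ?_ ⟨f, hf⟩
  exact ⟨l1 x, by rintro _ ⟨g, rfl⟩; exact g.2.le_l1 h0 h1 x⟩

lemma norming_le_l1 (h0 : 0 < θ) (h1 : θ < 1) (x : C00) : norming θ x ≤ l1 x :=
  ciSup_le fun f => f.2.le_l1 h0 h1 x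

/-- The supremum of the norming functionals, as a seminorm. -/
def normingSeminorm (h0 : 0 < θ) (h1 : θ < 1) : Seminorm ℝ C00 :=
  Seminorm.ofSMulLE (norming θ)
    (by
      have h : ∀ f : {f // Norming θ f}, f.1 0 = 0 := fun f => by
        simpa using f.2.map_smul 0 0
      simp [norming, h])
    (fun x y => ciSup_le fun f => by
      rw [f.2.map_add]
      exact add_le_add (le_norming h0 h1 f.2 x) (le_norming h0 h1 f.2 y))
    (fun c x => ciSup_le fun f => by
      rw [f.2.map_smul]
      have h2 : |f.1 x| ≤ norming θ x :=
        abs_le.2 ⟨by linarith [le_norming h0 h1 f.2.neg_mem x], le_norming h0 h1 f.2 x⟩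
      calc c * f.1 x ≤ |c * f.1 x| := le_abs_self _
        _ = ‖c‖ * |f.1 x| := by rw [abs_mul, Real.norm_eq_abs]
        _ ≤ _ := mul_le_mul_of_nonneg_left h2 (norm_nonneg _))

lemma isTsirelsonNorm_normingSeminorm (h0 : 0 < θ) (h1 : θ < 1) :
    IsTsirelsonNorm θ (normingSeminorm h0 h1) := by
  intro x
  have hN : ∀ y, normingSeminorm h0 h1 y = norming θ y := fun _ => rfl
  have hne : (admissibleSums (normingSeminorm h0 h1) x).Nonempty :=
    ⟨_, 0, fun j => j.elim0, ⟨fun j => j.elim0, fun j => j.elim0, fun j => j.elim0⟩, rfl⟩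
  have hbdd : BddAbove (admissibleSums (normingSeminorm h0 h1) x) := by
    refine ⟨l1 x, ?_⟩
    rintro _ ⟨k, E, hE, rfl⟩
    exact (Finset.sum_le_sum fun j _ => norming_le_l1 h0 h1 _).trans (sum_l1_le hE x)
  have hlub := isLUB_csSup hne hbdd
  refine ⟨_, hlub, le_antisymm ?_ (max_le ?_ ?_)⟩
  · refine ciSup_le fun f => ?_
    obtain ⟨f, hf⟩ := f
    cases hf with
    | pos n => exact le_max_of_le_left ((le_abs_self _).trans (abs_le_supNorm x n))
    | neg n => exact le_max_of_le_left ((neg_le_abs _).trans (abs_le_supNorm x n))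
    | comb E hE f hf =>
      refine le_max_of_le_right (mul_le_mul_of_nonneg_left ?_ h0.le)
      exact (Finset.sum_le_sum fun j _ => le_norming h0 h1 (hf j) _).trans
        (hlub.1 ⟨_, E, hE, rfl⟩)
  · refine ciSup_le fun n => abs_le.2 ⟨?_, le_norming h0 h1 (.pos n) x⟩
    have := le_norming h0 h1 (.neg n) x
    rw [hN]; linarith
  · rw [mul_comm, ← le_div_iff₀ h0]
    refine csSup_le hne ?_
    rintro _ ⟨k, E, hE, rfl⟩
    refine le_of_forall_pos_le_add fun ε hε => ?_
    have hk : (0 : ℝ) < k + 1 := by positivity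
    have hex : ∀ j, ∃ f : {f // Norming θ f},
        norming θ (restrict (E j) x) - ε / (k + 1) < f.1 (restrict (E j) x) := fun j =>
      exists_lt_of_lt_ciSup (sub_lt_self _ (by positivity))
    choose f hf using hex
    have h2 := le_norming h0 h1 (Norming.comb E hE (fun j => (f j).1) fun j => (f j).2) x
    have h3 : ∑ j, norming θ (restrict (E j) x) ≤
        ∑ j, ((f j).1 (restrict (E j) x) + ε / (k + 1)) :=
      Finset.sum_le_sum fun j _ => by linarith [hf j]
    rw [Finset.sum_add_distrib, Finset.sum_const, Finset.card_univ, Fintype.card_fin,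
      nsmul_eq_mul] at h3
    have h4 : (k : ℝ) * (ε / (k + 1)) ≤ ε := by
      rw [mul_div_assoc', div_le_iff₀ hk]; nlinarith
    have h5 : ∑ j, (f j).1 (restrict (E j) x) ≤ norming θ x / θ := by
      rw [le_div_iff₀ h0]; linarith
    simp only [hN]
    linarith

lemma le_of_isTsirelsonNorm (h0 : 0 < θ) (h1 : θ < 1) {N N' : Seminorm ℝ C00}
    (hN : IsTsirelsonNorm θ N) (hN' : IsTsirelsonNorm θ N') :
    ∀ (m : ℕ) (x : C00), x.support.card = m → N x ≤ N' x := by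
  intro m
  induction m using Nat.strong_induction_on with
  | _ m ih =>
    rintro x rfl
    obtain ⟨s, hs, hx⟩ := hN x
    obtain ⟨s', hs', hx'⟩ := hN' x
    -- A family either has a member that contains the support of `x`, or only smaller pieces.
    have key : s ≤ max s' (N x) := by
      refine hs.2 ?_
      rintro _ ⟨k, E, hE, rfl⟩
      by_cases h : ∃ j, x.support ⊆ E j
      · obtain ⟨j, hj⟩ := h
        refine le_max_of_le_right ?_
        rw [Finset.sum_eq_single j]
        · refine le_of_eq (congrArg N ?_)
          ext n
          rw [restrict_apply]
          split_ifs with hn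
          · rfl
          · by_contra h
            exact hn (hj (by simpa using Ne.symm h))
        · intro i _ hij
          have : restrict (E i) x = 0 := by
            ext n
            rw [restrict_apply]
            split_ifs with hn
            · by_contra hx0
              have hnj : n ∈ E j := hj (by simpa using hx0)
              rcases lt_or_gt_of_ne hij with h | h
              · exact lt_irrefl _ (hE.lt _ _ h _ hn _ hnj)
              · exact lt_irrefl _ (hE.lt _ _ h _ hnj _ hn)
            · rfl
          rw [this, map_zero]
        · simp
      · push Not at h
        refine le_max_of_le_left (le_trans (Finset.sum_le_sum fun j _ => ?_) (hs'.1 ⟨k, E, hE, rfl⟩))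
        refine ih _ (Finset.card_lt_card ?_) _ rfl
        obtain ⟨n, hn, hnE⟩ := Finset.not_subset.1 (h j)
        exact (Finset.ssubset_iff_of_subset (support_restrict_subset _ x)).2
          ⟨n, hn, by simp [restrict_apply, hnE]⟩
    have hpos : 0 ≤ N' x := apply_nonneg N' x
    have hsup : supNorm x ≤ N' x := by rw [hx']; exact le_max_left _ _
    have hsum : θ * s' ≤ N' x := by rw [hx']; exact le_max_right _ _
    rcases le_max_iff.1 (le_of_eq hx) with h | h
    · exact h.trans hsup
    · rcases le_max_iff.1 key with h' | h'
      · exact h.trans ((mul_le_mul_of_nonneg_left h' h0.le).trans hsum)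
      · have : θ * s ≤ θ * N x := mul_le_mul_of_nonneg_left h' h0.le
        nlinarith

end

/-- There is a unique norm on `c₀₀` that satisfies the implicit equation. -/
theorem existsUnique_isTsirelsonNorm {θ : ℝ} (hθ : θ ∈ Set.Ioo (0 : ℝ) 1) :
    ∃! N : Seminorm ℝ C00, IsTsirelsonNorm θ N :=
  ⟨normingSeminorm hθ.1 hθ.2, isTsirelsonNorm_normingSeminorm hθ.1 hθ.2, fun _ hN =>
    Seminorm.ext fun x => le_antisymm
      (le_of_isTsirelsonNorm hθ.1 hθ.2 hN (isTsirelsonNorm_normingSeminorm hθ.1 hθ.2) _ x rfl)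
      (le_of_isTsirelsonNorm hθ.1 hθ.2 (isTsirelsonNorm_normingSeminorm hθ.1 hθ.2) hN _ x rfl)⟩

/-- The norm of `T_θ` on `c₀₀`: the unique one that satisfies the implicit equation. -/
def tsirelsonNorm (θ : Set.Ioo (0 : ℝ) 1) : Seminorm ℝ C00 :=
  (existsUnique_isTsirelsonNorm θ.2).choose

theorem isTsirelsonNorm_tsirelsonNorm (θ : Set.Ioo (0 : ℝ) 1) :
    IsTsirelsonNorm θ (tsirelsonNorm θ) :=
  (existsUnique_isTsirelsonNorm θ.2).choose_spec.1

theorem eq_zero_of_tsirelsonNorm_eq_zero (θ : Set.Ioo (0 : ℝ) 1) (x : C00)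
    (hx : tsirelsonNorm θ x = 0) : x = 0 := by
  obtain ⟨s, -, h⟩ := isTsirelsonNorm_tsirelsonNorm θ x
  ext n
  have h1 : |x n| ≤ 0 := by
    rw [← hx, h]
    exact (abs_le_supNorm x n).trans (le_max_left _ _)
  simpa using h1

/-- The space `c₀₀` with the norm of `T_θ`. -/
def PreTsirelson (_θ : Set.Ioo (0 : ℝ) 1) : Type := C00

variable (θ : Set.Ioo (0 : ℝ) 1)

instance : AddCommGroup (PreTsirelson θ) := inferInstanceAs (AddCommGroup C00)

instance : Module ℝ (PreTsirelson θ) := inferInstanceAs (Module ℝ C00)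

instance : Norm (PreTsirelson θ) := ⟨fun x => tsirelsonNorm θ x⟩

theorem preTsirelson_core : NormedSpace.Core ℝ (PreTsirelson θ) where
  norm_nonneg x := apply_nonneg (tsirelsonNorm θ) x
  norm_smul c x := map_smul_eq_mul (tsirelsonNorm θ) c x
  norm_triangle x y := map_add_le_add (tsirelsonNorm θ) x y
  norm_eq_zero_iff x :=
    ⟨eq_zero_of_tsirelsonNorm_eq_zero θ x, fun h => h ▸ map_zero (tsirelsonNorm θ)⟩

instance : NormedAddCommGroup (PreTsirelson θ) := NormedAddCommGroup.ofCore (preTsirelson_core θ)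

instance : NormedSpace ℝ (PreTsirelson θ) := NormedSpace.ofCore (preTsirelson_core θ)

end Tsirelson

/-- Tsirelson's space `T_θ`: the completion of `c₀₀` in the norm of `T_θ`. -/
abbrev TsirelsonSpace (θ : Set.Ioo (0 : ℝ) 1) : Type :=
  UniformSpace.Completion (Tsirelson.PreTsirelson θ)

/-- The original Tsirelson space `T*_θ`: the Banach space dual of `T_θ`. -/
abbrev OriginalTsirelsonSpace (θ : Set.Ioo (0 : ℝ) 1) : Type :=
  StrongDual ℝ (TsirelsonSpace θ)

end

/-! Lower bound: the coordinate functionals `e_n^*` lie in the dual ball. Testing `e_m^* ± e_n^*` on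
`e_m ± e_n`, whose norm is at most `max 1 (2θ)`, gives symmetric separation `2 / max 1 (2θ)`, which
is the claimed value (`le_norm_add_smul_of_coordinate`).

Upper bound: `2` is the triangle inequality. For `1/θ` (`exists_norm_sub_le`), let `f` be a weak*
limit of a sequence `F` in the dual ball. Since the basis is shrinking, every functional is small on
far tails. So there are `m ≠ n` and `M < M'` such that, up to small errors, `F m - F n` vanishes on
`[1, M]`, equals `F m` on `(M, M']` and equals `-F n` beyond `M'`. Two successive sets beyond `1`
are admissible, so the corresponding pieces of `x` have norms adding up to at most `‖x‖ / θ`.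

Shrinking (`exists_tail_le_of_pos`): if the tail norms of `g` decreased to `δ > 0`, there would be a
block sequence in the unit ball on which `g` is nearly `δ`. A first block plus a long average of
later ones has norm at most about `1 + θ` (`tsirelsonNorm_add_average_le`), while `g` is nearly `2δ`
there. As `θ < 1`, this is impossible. -/

namespace Tsirelson

/-! Elementary properties of the norm of `T_θ` -/

section Norm

variable (θ : Set.Ioo (0 : ℝ) 1)

/-- This makes induction over norming functionals available. -/
lemma tsirelsonNorm_eq_norming (x : C00) : tsirelsonNorm θ x = norming θ x := by
  have h := (existsUnique_isTsirelsonNorm θ.2).unique (isTsirelsonNorm_tsirelsonNorm θ)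
    (isTsirelsonNorm_normingSeminorm θ.2.1 θ.2.2)
  rw [h]
  rfl

lemma tsirelsonNorm_le_l1 (x : C00) : tsirelsonNorm θ x ≤ l1 x :=
  (tsirelsonNorm_eq_norming θ x).trans_le (norming_le_l1 θ.2.1 θ.2.2 x)

lemma abs_le_tsirelsonNorm (x : C00) (n : ℕ+) : |x n| ≤ tsirelsonNorm θ x := by
  obtain ⟨s, -, h⟩ := isTsirelsonNorm_tsirelsonNorm θ x
  rw [h]
  exact (abs_le_supNorm x n).trans (le_max_left _ _)

lemma mul_sum_le_tsirelsonNorm (x : C00) {k : ℕ} {E : Fin k → Finset ℕ+} (hE : IsAdmissible E) :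
    θ * ∑ j, tsirelsonNorm θ (restrict (E j) x) ≤ tsirelsonNorm θ x := by
  obtain ⟨s, hs, h⟩ := isTsirelsonNorm_tsirelsonNorm θ x
  rw [h]
  exact (mul_le_mul_of_nonneg_left (hs.1 ⟨k, E, hE, rfl⟩) θ.2.1.le).trans (le_max_right _ _)

lemma tsirelsonNorm_le {x : C00} {C : ℝ} (h₁ : ∀ n, |x n| ≤ C)
    (h₂ : ∀ (k : ℕ) (E : Fin k → Finset ℕ+), IsAdmissible E →
      θ * ∑ j, tsirelsonNorm θ (restrict (E j) x) ≤ C) :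
    tsirelsonNorm θ x ≤ C := by
  obtain ⟨s, hs, h⟩ := isTsirelsonNorm_tsirelsonNorm θ x
  rw [h]
  refine max_le (ciSup_le h₁) ?_
  rw [mul_comm, ← le_div_iff₀ θ.2.1]
  refine hs.2 ?_
  rintro _ ⟨k, E, hE, rfl⟩
  rw [le_div_iff₀ θ.2.1, mul_comm]
  exact h₂ k E hE

/-- The unit vector basis is `1`-suppression unconditional. -/
lemma tsirelsonNorm_filter_le (p : ℕ+ → Prop) [DecidablePred p] (x : C00) :
    tsirelsonNorm θ (x.filter p) ≤ tsirelsonNorm θ x := by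
  rw [tsirelsonNorm_eq_norming θ (x.filter p)]
  refine ciSup_le ?_
  rintro ⟨f, hf⟩
  change f (x.filter p) ≤ _
  induction hf generalizing x with
  | pos n =>
    simp only [Finsupp.filter_apply]
    split_ifs
    · exact (le_abs_self _).trans (abs_le_tsirelsonNorm θ x n)
    · exact apply_nonneg _ _
  | neg n =>
    simp only [Finsupp.filter_apply]
    split_ifs
    · exact (neg_le_abs _).trans (abs_le_tsirelsonNorm θ x n)
    · rw [neg_zero]
      exact apply_nonneg _ _
  | comb E hE f hf ih =>
    refine le_trans (mul_le_mul_of_nonneg_left (Finset.sum_le_sum fun j _ => ?_) θ.2.1.le)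
      (mul_sum_le_tsirelsonNorm θ x hE)
    -- Suppression commutes with restriction, so the induction hypothesis applies to each piece `E_j
    -- x`.
    have h : restrict (E j) (x.filter p) = (restrict (E j) x).filter p := by
      ext n
      simp only [restrict, Finsupp.filter_apply]
      split_ifs <;> rfl
    rw [h]
    exact ih j _

lemma tsirelsonNorm_restrict_le (E : Finset ℕ+) (x : C00) :
    tsirelsonNorm θ (restrict E x) ≤ tsirelsonNorm θ x :=
  tsirelsonNorm_filter_le θ _ x

/-- Two successive intervals that start beyond `1` form an admissible family. -/
lemma tsirelsonNorm_filter_add_filter_le (x : C00) {M M' : ℕ} (hM : 1 ≤ M) (h : M < M') :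
    tsirelsonNorm θ (x.filter fun n : ℕ+ => M < (n : ℕ) ∧ (n : ℕ) ≤ M') +
      tsirelsonNorm θ (x.filter fun n : ℕ+ => M' < (n : ℕ)) ≤ tsirelsonNorm θ x / θ := by
  have hM' : 0 < M' := by omega
  set a : ℕ+ := ⟨M', hM'⟩
  -- The point `a + 1` keeps the second set nonempty when `x` vanishes beyond `M'`. Admissibility
  -- for `k = 2` needs both sets to start at `2` or later, hence `1 ≤ M`.
  set E : Fin 2 → Finset ℕ+ := ![Finset.Ioc ⟨M, hM⟩ a, insert (a + 1) (x.support.filter (a < ·))]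
  have hE : IsAdmissible E := by
    refine ⟨fun i => ?_, fun i n hn => ?_, fun i j hij m hm n hn => ?_⟩
    · fin_cases i
      · exact ⟨a, Finset.mem_Ioc.2 ⟨h, le_rfl⟩⟩
      · exact ⟨a + 1, Finset.mem_insert_self _ _⟩
    · have h1 : M < (n : ℕ) := by
        fin_cases i
        · exact (Finset.mem_Ioc.1 hn).1
        · rcases Finset.mem_insert.1 hn with rfl | hn
          · change M < M' + 1
            omega
          · exact h.trans (Finset.mem_filter.1 hn).2
      omega
    · fin_cases i <;> fin_cases j <;> simp at hij
      refine (Finset.mem_Ioc.1 hm).2.trans_lt ?_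
      rcases Finset.mem_insert.1 hn with rfl | hn
      · exact PNat.lt_add_right a 1
      · exact (Finset.mem_filter.1 hn).2
  have h0 : restrict (E 0) x = x.filter fun n : ℕ+ => M < (n : ℕ) ∧ (n : ℕ) ≤ M' := by
    ext n
    simp only [restrict, Finsupp.filter_apply]
    refine if_congr ?_ rfl rfl
    exact Finset.mem_Ioc
  have h1 : restrict (E 1) x = x.filter fun n : ℕ+ => M' < (n : ℕ) := by
    ext n
    simp only [restrict, Finsupp.filter_apply]
    by_cases hn : x n = 0
    · simp [hn]
    · refine if_congr ?_ rfl rfl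
      change n ∈ insert (a + 1) (x.support.filter (a < ·)) ↔ a < n
      rw [Finset.mem_insert, Finset.mem_filter, Finsupp.mem_support_iff]
      refine ⟨?_, fun h => Or.inr ⟨hn, h⟩⟩
      rintro (rfl | h)
      · exact PNat.lt_add_right a 1
      · exact h.2
  have := mul_sum_le_tsirelsonNorm θ x hE
  rw [Fin.sum_univ_two, h0, h1] at this
  rwa [le_div_iff₀' θ.2.1]

/-- The coordinates are at most `1`, and disjoint pieces have total `ℓ₁` norm at most `2`. -/
lemma tsirelsonNorm_single_add_single_le {m n : ℕ+} (hmn : m ≠ n) {a b : ℝ} (ha : |a| ≤ 1)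
    (hb : |b| ≤ 1) :
    tsirelsonNorm θ (Finsupp.single m a + Finsupp.single n b) ≤ max 1 (2 * (θ : ℝ)) := by
  set x : C00 := Finsupp.single m a + Finsupp.single n b with hx
  have hl : l1 x ≤ 2 := by
    have : l1 x ≤ ∑ i ∈ ({m, n} : Finset ℕ+), |x i| := by
      refine Finset.sum_le_sum_of_subset_of_nonneg (fun i hi => ?_) fun _ _ _ => abs_nonneg _
      by_contra h
      simp only [Finset.mem_insert, Finset.mem_singleton, not_or] at h
      simp [hx, Ne.symm h.1, Ne.symm h.2] at hi
    rw [Finset.sum_pair hmn] at this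
    simp [hx, hmn, hmn.symm] at this
    linarith
  refine tsirelsonNorm_le θ (fun i => le_max_of_le_left ?_) fun k E hE => le_max_of_le_right ?_
  · rw [hx, Finsupp.add_apply, Finsupp.single_apply, Finsupp.single_apply]
    split_ifs with h1 h2
    · exact absurd (h1.trans h2.symm) hmn
    · simpa using ha
    · simpa using hb
    · simp
  · rw [mul_comm]
    refine mul_le_mul_of_nonneg_right ?_ θ.2.1.le
    exact (Finset.sum_le_sum fun j _ => tsirelsonNorm_le_l1 θ _).trans ((sum_l1_le hE x).trans hl)

end Norm

/-! Averages of block sequences -/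

section Blocks

variable (θ : Set.Ioo (0 : ℝ) 1) {M : ℕ → ℕ} {v : ℕ → C00}

lemma sum_tsirelsonNorm_restrict_le {k : ℕ} {E : Fin k → Finset ℕ+} (hE : IsAdmissible E)
    {x : C00} (hx : tsirelsonNorm θ x ≤ 1) :
    ∑ j, tsirelsonNorm θ (restrict (E j) x) ≤ 1 / θ := by
  rw [le_div_iff₀' θ.2.1]
  exact (mul_sum_le_tsirelsonNorm θ x hE).trans hx

/-- At most one summand survives, so a vector that is not split contributes `1` instead of `1/θ`. -/
lemma sum_tsirelsonNorm_restrict_le_one {k : ℕ} {E : Fin k → Finset ℕ+} {x : C00}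
    (hx : tsirelsonNorm θ x ≤ 1)
    (h : ∀ i j, i < j → restrict (E i) x = 0 ∨ restrict (E j) x = 0) :
    ∑ j, tsirelsonNorm θ (restrict (E j) x) ≤ 1 := by
  by_cases h0 : ∃ i, restrict (E i) x ≠ 0
  · obtain ⟨i, hi⟩ := h0
    rw [Finset.sum_eq_single i]
    · exact (tsirelsonNorm_restrict_le θ _ x).trans hx
    · intro j _ hij
      have : restrict (E j) x = 0 := by
        rcases lt_or_gt_of_ne hij with hij | hij
        · exact (h _ _ hij).resolve_right hi
        · exact (h _ _ hij).resolve_left hi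
      rw [this, map_zero]
    · simp
  · push Not at h0
    simp [h0]

lemma exists_mem_of_restrict_ne_zero {E : Finset ℕ+} {x : C00} (h : restrict E x ≠ 0) :
    ∃ n ∈ E, x n ≠ 0 := by
  obtain ⟨n, hn⟩ := Finsupp.ne_iff.1 h
  rw [restrict_apply] at hn
  by_cases hnE : n ∈ E
  · exact ⟨n, hnE, by simpa [hnE] using hn⟩
  · simp [hnE] at hn

open Classical in
/-- At most `k` of the vectors of a block sequence are split by an admissible family of `k` sets. -/
lemma card_split_le (hM : Monotone M)
    (hv : ∀ i n, v i n ≠ 0 → M i < (n : ℕ) ∧ (n : ℕ) ≤ M (i + 1)) {k : ℕ}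
    {E : Fin k → Finset ℕ+} (hE : IsAdmissible E) (s : Finset ℕ) :
    (s.filter fun i => ∃ a b, a < b ∧ restrict (E a) (v i) ≠ 0 ∧
      restrict (E b) (v i) ≠ 0).card ≤ k := by
  have hlt : ∀ i i' m n, i < i' → v i m ≠ 0 → v i' n ≠ 0 → m < n := fun i i' m n hi hm hn =>
    PNat.coe_lt_coe _ _ |>.1 <|
      (hv i m hm).2.trans_lt ((hM (Nat.succ_le_of_lt hi)).trans_lt (hv i' n hn).1)
  have hne : ∀ i i' a b, i < i' → a < b → restrict (E b) (v i) ≠ 0 →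
      restrict (E a) (v i') ≠ 0 → False := by
    intro i i' a b hi hab h h'
    obtain ⟨n, hn, hn0⟩ := exists_mem_of_restrict_ne_zero h
    obtain ⟨m, hm, hm0⟩ := exists_mem_of_restrict_ne_zero h'
    exact lt_asymm (hE.lt a b hab m hm n hn) (hlt i i' n m hi hn0 hm0)
  set t := s.filter fun i => ∃ a b, a < b ∧ restrict (E a) (v i) ≠ 0 ∧ restrict (E b) (v i) ≠ 0
  have ht : ∀ i : t, ∃ a b, a < b ∧ restrict (E a) (v i) ≠ 0 ∧ restrict (E b) (v i) ≠ 0 :=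
    fun i => (Finset.mem_filter.1 i.2).2
  choose a b hab ha hb using ht
  -- Two split vectors cannot share their set `E_a`: the earlier one also meets a later set `E_b`,
  -- which would then have a point before one of `E_a`.
  have hinj : Function.Injective a := by
    intro i i' h
    by_contra hii
    rcases lt_or_gt_of_ne (fun h : (i : ℕ) = i' => hii (Subtype.ext h)) with hlt' | hlt'
    · exact hne i i' (a i) (b i) hlt' (hab i) (hb i) (h ▸ ha i')
    · exact hne i' i (a i') (b i') hlt' (hab i') (hb i') (h ▸ ha i)
  simpa using Fintype.card_le_of_injective a hinj

lemma tsirelsonNorm_average_le (hv1 : ∀ i, tsirelsonNorm θ (v i) ≤ 1) {r : ℕ} (hr : 0 < r) :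
    tsirelsonNorm θ ((r : ℝ)⁻¹ • ∑ i ∈ Finset.range r, v (i + 1)) ≤ 1 := by
  have hr' : (0 : ℝ) < r := by exact_mod_cast hr
  rw [map_smul_eq_mul, Real.norm_of_nonneg (by positivity), inv_mul_le_iff₀ hr', mul_one]
  refine (Finset.le_sum_of_subadditive _ (map_zero _).le (map_add_le_add _) _ _).trans ?_
  exact (Finset.sum_le_sum fun i _ => hv1 (i + 1)).trans (by simp)

/-- Each of the at most `k` split vectors contributes up to `1/θ`, all others at most `1`. The
excess is negligible once `r` is large compared with `k`. -/
lemma sum_tsirelsonNorm_restrict_average_le (hM : Monotone M)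
    (hv : ∀ i n, v i n ≠ 0 → M i < (n : ℕ) ∧ (n : ℕ) ≤ M (i + 1))
    (hv1 : ∀ i, tsirelsonNorm θ (v i) ≤ 1) {r : ℕ} (hr : 0 < r) {k : ℕ}
    {E : Fin k → Finset ℕ+} (hE : IsAdmissible E) :
    ∑ j, tsirelsonNorm θ (restrict (E j) ((r : ℝ)⁻¹ • ∑ i ∈ Finset.range r, v (i + 1))) ≤
      1 + k / θ / r := by
  classical
  have hθ : (0 : ℝ) < θ := θ.2.1
  have hr' : (0 : ℝ) < r := by exact_mod_cast hr
  set bad : ℕ → Prop := fun i => ∃ a b, a < b ∧ restrict (E a) (v (i + 1)) ≠ 0 ∧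
      restrict (E b) (v (i + 1)) ≠ 0
  have hres : ∀ j, tsirelsonNorm θ (restrict (E j) ((r : ℝ)⁻¹ • ∑ i ∈ Finset.range r, v (i + 1)))
      ≤ (r : ℝ)⁻¹ * ∑ i ∈ Finset.range r, tsirelsonNorm θ (restrict (E j) (v (i + 1))) := by
    intro j
    rw [restrict_smul, map_smul_eq_mul, Real.norm_of_nonneg (by positivity)]
    refine mul_le_mul_of_nonneg_left ?_ (by positivity)
    exact Finset.le_sum_of_subadditive (fun x => tsirelsonNorm θ (restrict (E j) x))
      (by simp [restrict, Finsupp.filter_zero]) (fun x y => by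
        rw [restrict_add]
        exact map_add_le_add _ _ _) _ _
  have hi : ∀ i, ∑ j, tsirelsonNorm θ (restrict (E j) (v (i + 1))) ≤
      1 + if bad i then 1 / (θ : ℝ) else 0 := by
    intro i
    split_ifs with h
    · exact (sum_tsirelsonNorm_restrict_le θ hE (hv1 _)).trans (by linarith)
    · rw [add_zero]
      refine sum_tsirelsonNorm_restrict_le_one θ (hv1 _) fun a b hab => ?_
      by_contra hc
      push Not at hc
      exact h ⟨a, b, hab, hc⟩
  have hcard : ((Finset.range r).filter bad).card ≤ k :=
    card_split_le (M := fun i => M (i + 1)) (v := fun i => v (i + 1))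
      (fun i j hij => hM (Nat.succ_le_succ hij)) (fun i n => hv (i + 1) n) hE _
  calc _ ≤ ∑ j, (r : ℝ)⁻¹ * ∑ i ∈ Finset.range r, tsirelsonNorm θ (restrict (E j) (v (i + 1))) :=
        Finset.sum_le_sum fun j _ => hres j
    _ = (r : ℝ)⁻¹ * ∑ i ∈ Finset.range r, ∑ j, tsirelsonNorm θ (restrict (E j) (v (i + 1))) := by
        rw [← Finset.mul_sum, Finset.sum_comm]
    _ ≤ (r : ℝ)⁻¹ * ∑ i ∈ Finset.range r, (1 + if bad i then 1 / (θ : ℝ) else 0) := by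
        refine mul_le_mul_of_nonneg_left (Finset.sum_le_sum fun i _ => hi i) (by positivity)
    _ = (r : ℝ)⁻¹ * (r + ((Finset.range r).filter bad).card * (1 / θ)) := by
        rw [Finset.sum_add_distrib, ← Finset.sum_filter]
        simp
    _ ≤ (r : ℝ)⁻¹ * (r + k * (1 / θ)) := by
        have : (((Finset.range r).filter bad).card : ℝ) ≤ k := by exact_mod_cast hcard
        gcongr
    _ = _ := by field_simp

/-- A block sequence in `T_θ` is not nearly isometrically `ℓ₁` over positive combinations. -/
lemma tsirelsonNorm_add_average_le (hM : Monotone M)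
    (hv : ∀ i n, v i n ≠ 0 → M i < (n : ℕ) ∧ (n : ℕ) ≤ M (i + 1))
    (hv1 : ∀ i, tsirelsonNorm θ (v i) ≤ 1) {r : ℕ} (hr : 0 < r) :
    tsirelsonNorm θ (v 0 + (r : ℝ)⁻¹ • ∑ i ∈ Finset.range r, v (i + 1)) ≤
      1 + θ + (M 1 : ℝ) / r := by
  have hθ : (0 : ℝ) < θ := θ.2.1
  have hr' : (0 : ℝ) < r := by exact_mod_cast hr
  set y : C00 := (r : ℝ)⁻¹ • ∑ i ∈ Finset.range r, v (i + 1) with hy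
  have hy1 : tsirelsonNorm θ y ≤ 1 := tsirelsonNorm_average_le θ hv1 hr
  have hC : (1 : ℝ) ≤ 1 + θ + (M 1 : ℝ) / r := by
    have : (0 : ℝ) ≤ (M 1 : ℝ) / r := by positivity
    linarith
  have hv0 : ∀ n : ℕ+, M 1 < (n : ℕ) → v 0 n = 0 := fun n hn => by
    by_contra h
    exact absurd (hv 0 n h).2 (not_le.2 hn)
  refine tsirelsonNorm_le θ (fun n => le_trans ?_ hC) fun k E hE => ?_
  · rw [Finsupp.add_apply]
    rcases le_or_gt (n : ℕ) (M 1) with hn | hn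
    · have : y n = 0 := by
        have : ∀ i ∈ Finset.range r, v (i + 1) n = 0 := fun i _ => by
          by_contra h
          exact absurd ((hM (Nat.le_add_left 1 i)).trans_lt (hv (i + 1) n h).1) (not_lt.2 hn)
        rw [hy, Finsupp.smul_apply, Finsupp.finsetSum_apply, Finset.sum_eq_zero this, smul_zero]
      rw [this, add_zero]
      exact (abs_le_tsirelsonNorm θ _ n).trans (hv1 0)
    · rw [hv0 n hn, zero_add]
      exact (abs_le_tsirelsonNorm θ _ n).trans hy1
  -- A family with `k > M 1` misses `v 0` altogether. Otherwise `v 0` accounts for at most `1`, and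
  -- the average, hardly split by so few sets, for about `θ`.
  · rcases lt_or_ge (M 1) k with hk | hk
    · have : ∀ j, restrict (E j) (v 0 + y) = restrict (E j) y := fun j => by
        ext n
        rw [restrict_apply, restrict_apply]
        split_ifs with hn
        · rw [Finsupp.add_apply, hv0 n (hk.trans_le (hE.le j n hn)), zero_add]
        · rfl
      simp only [this]
      exact ((mul_sum_le_tsirelsonNorm θ y hE).trans hy1).trans hC
    · have h1 : ∑ j, tsirelsonNorm θ (restrict (E j) (v 0 + y)) ≤
          ∑ j, tsirelsonNorm θ (restrict (E j) (v 0)) + ∑ j, tsirelsonNorm θ (restrict (E j) y) := by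
        rw [← Finset.sum_add_distrib]
        refine Finset.sum_le_sum fun j _ => ?_
        rw [restrict_add]
        exact map_add_le_add _ _ _
      have h2 := (mul_sum_le_tsirelsonNorm θ (v 0) hE).trans (hv1 0)
      have h3 := sum_tsirelsonNorm_restrict_average_le θ hM hv hv1 hr hE
      have hk' : (k : ℝ) ≤ M 1 := by exact_mod_cast hk
      calc _ ≤ θ * (∑ j, tsirelsonNorm θ (restrict (E j) (v 0))
            + ∑ j, tsirelsonNorm θ (restrict (E j) y)) := mul_le_mul_of_nonneg_left h1 hθ.le
        _ ≤ 1 + θ * (1 + k / θ / r) := by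
            rw [mul_add]
            exact add_le_add h2 (mul_le_mul_of_nonneg_left h3 hθ.le)
        _ = 1 + θ + k / r := by field_simp; ring
        _ ≤ _ := by gcongr

end Blocks

end Tsirelson

namespace Tsirelson

/-! The unit vector basis is shrinking -/

section Shrinking

variable (θ : Set.Ioo (0 : ℝ) 1)

lemma exists_block_sequence {P : C00 → Prop} (M₀ : ℕ)
    (h : ∀ M : ℕ, ∃ x, P x ∧ ∀ n : ℕ+, x n ≠ 0 → M < (n : ℕ)) :
    ∃ (M : ℕ → ℕ) (v : ℕ → C00), Monotone M ∧ M 0 = M₀ ∧ (∀ i, P (v i)) ∧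
      ∀ i n, v i n ≠ 0 → M i < (n : ℕ) ∧ (n : ℕ) ≤ M (i + 1) := by
  choose X hP hX using h
  set M : ℕ → ℕ := fun i => Nat.rec M₀ (fun _ m => m + (X m).support.sup fun n => (n : ℕ)) i
  refine ⟨M, fun i => X (M i), monotone_nat_of_le_succ fun i => Nat.le_add_right _ _, rfl,
    fun i => hP _, fun i n hn => ⟨hX _ n hn, ?_⟩⟩
  exact (Finset.le_sup (f := fun n : ℕ+ => (n : ℕ)) (Finsupp.mem_support_iff.2 hn)).trans
    (Nat.le_add_left _ _)

/-- If `g` is bounded by `c` beyond `M₀`, then it cannot be of norm more than `c'` on every tail,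
where `2 c' > c (1 + θ)`. -/
lemma exists_tail_le {g : C00 →ₗ[ℝ] ℝ} {c c' : ℝ} (hc : 0 ≤ c)
    (hcc : c * (1 + θ) < 2 * c') {M₀ : ℕ}
    (h : ∀ x : C00, (∀ n : ℕ+, x n ≠ 0 → M₀ < (n : ℕ)) → g x ≤ c * tsirelsonNorm θ x) :
    ∃ M : ℕ, ∀ x : C00, (∀ n : ℕ+, x n ≠ 0 → M < (n : ℕ)) → g x ≤ c' * tsirelsonNorm θ x := by
  by_contra hcon
  push Not at hcon
  have hex : ∀ M : ℕ, ∃ x : C00, (tsirelsonNorm θ x ≤ 1 ∧ c' ≤ g x) ∧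
      ∀ n : ℕ+, x n ≠ 0 → M < (n : ℕ) := by
    intro M
    obtain ⟨x, hx, hgx⟩ := hcon M
    have hpos : 0 < tsirelsonNorm θ x := by
      refine lt_of_le_of_ne (apply_nonneg _ _) fun h0 => ?_
      rw [eq_zero_of_tsirelsonNorm_eq_zero θ x h0.symm] at hgx
      simp at hgx
    refine ⟨(tsirelsonNorm θ x)⁻¹ • x, ⟨?_, ?_⟩, fun n hn => hx n fun h0 => hn (by simp [h0])⟩
    · rw [map_smul_eq_mul, Real.norm_of_nonneg (by positivity), inv_mul_cancel₀ hpos.ne']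
    · rw [map_smul, smul_eq_mul, le_inv_mul_iff₀ hpos, mul_comm]
      exact hgx.le
  obtain ⟨M, v, hM, hM0, hP, hv⟩ := exists_block_sequence M₀ hex
  -- So large that the error `c * M 1 / r` is below the gap `2 c' - c (1 + θ)`; the `max 0` forces
  -- `r > 0`.
  obtain ⟨r, hr⟩ := exists_nat_gt (max 0 (c * M 1 / (2 * c' - c * (1 + θ))))
  have hr' : (0 : ℝ) < r := (le_max_left _ _).trans_lt hr
  have hr0 : 0 < r := by exact_mod_cast hr'
  have hr2 : c * M 1 / r < 2 * c' - c * (1 + θ) := by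
    rw [div_lt_comm₀ hr' (by linarith)]
    exact (le_max_right _ _).trans_lt hr
  have hN := tsirelsonNorm_add_average_le θ hM hv (fun i => (hP i).1) hr0
  set y := (r : ℝ)⁻¹ • ∑ i ∈ Finset.range r, v (i + 1) with hy
  have hgy : c' ≤ g y := by
    rw [hy, map_smul, map_sum, smul_eq_mul, le_inv_mul_iff₀ hr']
    have := Finset.card_nsmul_le_sum (Finset.range r) (fun i => g (v (i + 1))) c'
      fun i _ => (hP (i + 1)).2
    simpa using this
  have hsupp : ∀ n : ℕ+, (v 0 + y) n ≠ 0 → M₀ < (n : ℕ) := by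
    intro n hn
    by_contra hle
    refine hn ?_
    have hz : ∀ i, v i n = 0 := fun i => by
      by_contra h0
      exact hle (hM0 ▸ (hM (Nat.zero_le i)).trans_lt (hv i n h0).1)
    simp [hy, hz]
  have hg := h _ hsupp
  rw [map_add] at hg
  have h1 := mul_le_mul_of_nonneg_left hN hc
  have h2 : c * (1 + θ + (M 1 : ℝ) / r) = c * (1 + θ) + c * M 1 / r := by ring
  linarith [(hP 0).2]

/-- The unit vector basis of `T_θ` is shrinking. -/
lemma exists_tail_le_of_pos {g : C00 →ₗ[ℝ] ℝ} {C : ℝ} (hC : 0 ≤ C)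
    (hg : ∀ x, |g x| ≤ C * tsirelsonNorm θ x) {ε : ℝ} (hε : 0 < ε) :
    ∃ M : ℕ, ∀ x : C00, (∀ n : ℕ+, x n ≠ 0 → M < (n : ℕ)) → |g x| ≤ ε * tsirelsonNorm θ x := by
  have hθ := θ.2.2
  have hθ0 := θ.2.1
  -- One-sided bounds valid on some tail. The infimum of `D` plays the role of the limit `δ` of the
  -- tail norms.
  set D : Set ℝ := {c | 0 ≤ c ∧ ∃ M : ℕ, ∀ x : C00, (∀ n : ℕ+, x n ≠ 0 → M < (n : ℕ)) →
    g x ≤ c * tsirelsonNorm θ x}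
  have hne : D.Nonempty := ⟨C, hC, 0, fun x _ => (le_abs_self _).trans (hg x)⟩
  have hbdd : BddBelow D := ⟨0, fun c hc => hc.1⟩
  have hinf : sInf D < ε := by
    by_contra hcon
    push Not at hcon
    have hδ : 0 < sInf D := hε.trans_le hcon
    set δ := sInf D
    -- With `θ = 1 - 6η`, `(1 + η)(1 + θ) = 2 - 4η - 6η² < 2(1 - η)`. So a tail bound below `δ(1 +
    -- η)` improves to `δ(1 - η)`, below the infimum.
    set η : ℝ := (1 - θ) / 6
    have hη : 0 < η := by simp only [η]; linarith
    obtain ⟨c, ⟨hc0, M₀, hc⟩, hcδ⟩ := exists_lt_of_csInf_lt hne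
      (show sInf D < δ * (1 + η) by change δ < _; nlinarith)
    have hη1 : η < 1 := by simp only [η]; linarith
    have hc' : 0 ≤ δ * (1 - η) := mul_nonneg hδ.le (by linarith)
    obtain ⟨M, hM⟩ := exists_tail_le θ (c' := δ * (1 - η)) hc0 (by
      have h1 : c * (1 + θ) ≤ δ * (1 + η) * (1 + θ) :=
        mul_le_mul_of_nonneg_right hcδ.le (by linarith)
      have h2 : (1 + η) * (1 + θ) < 2 * (1 - η) := by
        have : η * θ ≤ η := by nlinarith
        have : (θ : ℝ) = 1 - 6 * η := by simp only [η]; ring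
        nlinarith
      nlinarith [mul_lt_mul_of_pos_left h2 hδ]) hc
    have : δ ≤ δ * (1 - η) := csInf_le hbdd ⟨hc', M, hM⟩
    nlinarith
  obtain ⟨c, ⟨hc0, M, hc⟩, hcε⟩ := exists_lt_of_csInf_lt hne hinf
  refine ⟨M, fun x hx => abs_le'.2 ⟨?_, ?_⟩⟩
  · exact (hc x hx).trans (mul_le_mul_of_nonneg_right hcε.le (apply_nonneg _ _))
  · have := hc (-x) (fun n hn => hx n (by simpa using hn))
    rw [map_neg, map_neg_eq_map] at this
    exact this.trans (mul_le_mul_of_nonneg_right hcε.le (apply_nonneg _ _))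

end Shrinking

/-! Functionals on `T_θ` and on `c₀₀` -/

section Dual

variable {θ : Set.Ioo (0 : ℝ) 1}

/-- The restriction to `c₀₀` of a functional on `T_θ`. -/
noncomputable def toC00Dual : OriginalTsirelsonSpace θ →ₗ[ℝ] C00 →ₗ[ℝ] ℝ where
  toFun F := (F.comp (UniformSpace.Completion.toComplL (𝕜 := ℝ) (E := PreTsirelson θ))).toLinearMap
  map_add' _ _ := rfl
  map_smul' _ _ := rfl

lemma abs_toC00Dual_le (F : OriginalTsirelsonSpace θ) (x : C00) :
    |toC00Dual F x| ≤ ‖F‖ * tsirelsonNorm θ x := by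
  exact (F.le_opNorm (UniformSpace.Completion.coe' (α := PreTsirelson θ) x)).trans_eq
    (congrArg (‖F‖ * ·) (UniformSpace.Completion.norm_coe (E := PreTsirelson θ) x))

lemma abs_toC00Dual_le_of_norm_le {F : OriginalTsirelsonSpace θ} (hF : ‖F‖ ≤ 1) (x : C00) :
    |toC00Dual F x| ≤ tsirelsonNorm θ x :=
  (abs_toC00Dual_le F x).trans (mul_le_of_le_one_left (apply_nonneg _ _) hF)

/-- Both sides are continuous and `c₀₀` is dense in its completion. -/
lemma norm_le_of_toC00Dual_le {F : OriginalTsirelsonSpace θ} {C : ℝ} (hC : 0 ≤ C)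
    (h : ∀ x, |toC00Dual F x| ≤ C * tsirelsonNorm θ x) : ‖F‖ ≤ C := by
  refine F.opNorm_le_bound hC fun x => ?_
  induction x using UniformSpace.Completion.induction_on with
  | hp => exact isClosed_le (by fun_prop) (by fun_prop)
  | ih x =>
    rw [UniformSpace.Completion.norm_coe]
    exact h x

/-- A bounded functional on `c₀₀` extends to `T_θ`. -/
lemma exists_toC00Dual_eq {g : C00 →ₗ[ℝ] ℝ} {C : ℝ} (hC : 0 ≤ C)
    (h : ∀ x, |g x| ≤ C * tsirelsonNorm θ x) :
    ∃ F : OriginalTsirelsonSpace θ, ‖F‖ ≤ C ∧ toC00Dual F = g := by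
  let g' : StrongDual ℝ (PreTsirelson θ) := LinearMap.mkContinuous
    (show PreTsirelson θ →ₗ[ℝ] ℝ from g) C h
  let F : OriginalTsirelsonSpace θ := g'.extend UniformSpace.Completion.toComplL
  have hF : toC00Dual F = g := by
    refine LinearMap.ext fun x => ?_
    exact ContinuousLinearMap.extend_eq (e := UniformSpace.Completion.toComplL) g'
      UniformSpace.Completion.denseRange_coe (UniformSpace.Completion.isUniformInducing_coe _) x
  exact ⟨F, norm_le_of_toC00Dual_le hC (hF ▸ h), hF⟩

/-- Weak* compactness of the dual ball, along the ultrafilter `U`. -/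
lemma exists_tendsto_toC00Dual (U : Ultrafilter ℕ) {F : ℕ → OriginalTsirelsonSpace θ}
    (hF : ∀ n, ‖F n‖ ≤ 1) :
    ∃ f : OriginalTsirelsonSpace θ, ‖f‖ ≤ 1 ∧
      ∀ x, Filter.Tendsto (fun n => toC00Dual (F n) x) U (nhds (toC00Dual f x)) := by
  have hK := WeakDual.isCompact_closedBall (𝕜 := ℝ) (0 : OriginalTsirelsonSpace θ) 1
  obtain ⟨f, hf, hlim⟩ := hK.ultrafilter_le_nhds (U.map fun n => StrongDual.toWeakDual (F n)) (by
    refine Filter.le_principal_iff.2 (Filter.mem_map.2 (Filter.univ_mem' fun n => ?_))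
    simpa using hF n)
  refine ⟨WeakDual.toStrongDual f, by simpa using hf, fun x => ?_⟩
  exact ((WeakDual.eval_continuous (UniformSpace.Completion.coe' (α := PreTsirelson θ) x)).tendsto f).comp hlim

/-- A functional with small coordinates up to `M` is small on the vectors supported up to `M`. -/
lemma abs_le_of_sum_le (θ : Set.Ioo (0 : ℝ) 1) {g : C00 →ₗ[ℝ] ℝ} {M : ℕ} {ε : ℝ}
    (h : ∑ n ∈ (Finset.range M), |g (Finsupp.single n.succPNat 1)| ≤ ε) {x : C00}
    (hx : ∀ n : ℕ+, x n ≠ 0 → (n : ℕ) ≤ M) : |g x| ≤ ε * tsirelsonNorm θ x := by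
  -- `Nat.succPNat` sends `0, …, M - 1` to the coordinates `1, …, M`.
  have hsum : x = ∑ n ∈ Finset.range M, x n.succPNat • Finsupp.single n.succPNat (1 : ℝ) := by
    ext m
    rw [Finsupp.finsetSum_apply]
    by_cases hm : (m : ℕ) ≤ M
    · rw [Finset.sum_eq_single m.natPred]
      · simp
      · intro n _ hn
        have : n.succPNat ≠ m := fun h => hn (by rw [← h]; rfl)
        simp [this]
      · intro hn
        refine absurd ?_ hn
        have := m.pos
        rw [Finset.mem_range, PNat.natPred]
        omega
    · rw [Finset.sum_eq_zero]
      · by_contra h0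
        exact hm (hx m h0)
      · intro n hn
        have : n.succPNat ≠ m := fun h => hm (by
          rw [← h, Nat.succPNat_coe]; exact Finset.mem_range.1 hn)
        simp [this]
  calc |g x| = |∑ n ∈ Finset.range M, x n.succPNat * g (Finsupp.single n.succPNat 1)| := by
        conv_lhs => rw [hsum]
        simp only [map_sum, map_smul, smul_eq_mul]
    _ ≤ ∑ n ∈ Finset.range M, |x n.succPNat| * |g (Finsupp.single n.succPNat 1)| := by
        simp only [← abs_mul]
        exact Finset.abs_sum_le_sum_abs _ _
    _ ≤ ∑ n ∈ Finset.range M, tsirelsonNorm θ x * |g (Finsupp.single n.succPNat 1)| :=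
        Finset.sum_le_sum fun n _ =>
          mul_le_mul_of_nonneg_right (abs_le_tsirelsonNorm θ x _) (abs_nonneg _)
    _ ≤ ε * tsirelsonNorm θ x := by
        rw [← Finset.mul_sum, mul_comm]
        exact mul_le_mul_of_nonneg_right h (apply_nonneg _ _)

end Dual

end Tsirelson

namespace Tsirelson

/-! Separated sequences in the dual ball -/

section Separation

variable {θ : Set.Ioo (0 : ℝ) 1}

open Filter in
/-- Along a free ultrafilter, the first coordinates of a weak* convergent sequence are close to
those of the limit. -/
lemma eventually_sum_abs_le {U : Ultrafilter ℕ} {F : ℕ → OriginalTsirelsonSpace θ}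
    {f : OriginalTsirelsonSpace θ}
    (hf : ∀ x, Tendsto (fun n => toC00Dual (F n) x) U (nhds (toC00Dual f x))) (M : ℕ) {ε : ℝ}
    (hε : 0 < ε) :
    ∀ᶠ n in (U : Filter ℕ), ∑ i ∈ Finset.range M,
      |toC00Dual (F n - f) (Finsupp.single i.succPNat 1)| ≤ ε := by
  have h : Tendsto (fun n => ∑ i ∈ Finset.range M,
      |toC00Dual (F n - f) (Finsupp.single i.succPNat 1)|) U (nhds 0) := by
    rw [← Finset.sum_const_zero (s := Finset.range M)]
    refine tendsto_finsetSum _ fun i _ => ?_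
    have := ((hf (Finsupp.single i.succPNat 1)).sub_const
      (toC00Dual f (Finsupp.single i.succPNat 1))).abs
    simpa using this
  exact h.eventually_le_const hε

/-- The five `ε` come from `F m - f` and `F n - f` on the first piece of `x`, `F n - f` and `f` on
the second, and `F m` on the third. -/
lemma exists_norm_sub_le {F : ℕ → OriginalTsirelsonSpace θ} (hF : ∀ n, ‖F n‖ ≤ 1) {ε : ℝ}
    (hε : 0 < ε) : ∃ m n, m ≠ n ∧ ‖F m - F n‖ ≤ 1 / θ + 5 * ε := by
  have hθ : (0 : ℝ) < θ := θ.2.1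
  set U : Ultrafilter ℕ := Filter.hyperfilter ℕ
  obtain ⟨f, hf, hlim⟩ := exists_tendsto_toC00Dual U hF
  obtain ⟨M₁, hM₁⟩ := exists_tail_le_of_pos θ (norm_nonneg f) (abs_toC00Dual_le f) hε
  -- The `+ 1` ensures `1 ≤ M`, as the admissible pair below requires.
  set M := M₁ + 1
  have hclose := fun K => eventually_sum_abs_le hlim K hε
  obtain ⟨m, hm⟩ := (hclose M).exists
  obtain ⟨M₂, hM₂⟩ := exists_tail_le_of_pos θ (norm_nonneg _) (abs_toC00Dual_le (F m)) hε
  set M' := M + M₂ + 1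
  -- `n` is chosen after `M'`, which depends on `F m`. The ultrafilter is free, so `n` can avoid
  -- `m`.
  obtain ⟨n, ⟨hn, hn'⟩, hnm⟩ := (((hclose M).and (hclose M')).and
    ((Set.finite_singleton m).compl_mem_hyperfilter)).exists
  refine ⟨m, n, Ne.symm hnm, norm_le_of_toC00Dual_le (by positivity) fun x => ?_⟩
  set x₁ : C00 := x.filter fun i : ℕ+ => (i : ℕ) ≤ M with hx₁
  set x₂ : C00 := x.filter fun i : ℕ+ => M < (i : ℕ) ∧ (i : ℕ) ≤ M' with hx₂
  set x₃ : C00 := x.filter fun i : ℕ+ => M' < (i : ℕ) with hx₃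
  have hx : x = x₁ + x₂ + x₃ := by
    ext i
    simp only [hx₁, hx₂, hx₃, Finsupp.add_apply, Finsupp.filter_apply]
    have : M < M' := by omega
    split_ifs <;> first | omega | simp
  have s₁ : ∀ i : ℕ+, x₁ i ≠ 0 → (i : ℕ) ≤ M := fun i hi => by
    by_contra h
    exact hi (Finsupp.filter_apply_neg _ _ h)
  have s₂ : ∀ i : ℕ+, x₂ i ≠ 0 → M < (i : ℕ) ∧ (i : ℕ) ≤ M' := fun i hi => by
    by_contra h
    exact hi (Finsupp.filter_apply_neg _ _ h)
  have s₃ : ∀ i : ℕ+, x₃ i ≠ 0 → M' < (i : ℕ) := fun i hi => by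
    by_contra h
    exact hi (Finsupp.filter_apply_neg _ _ h)
  have n₁ : ε * tsirelsonNorm θ x₁ ≤ ε * tsirelsonNorm θ x :=
    mul_le_mul_of_nonneg_left (tsirelsonNorm_filter_le θ _ x) hε.le
  have n₂ : ε * tsirelsonNorm θ x₂ ≤ ε * tsirelsonNorm θ x :=
    mul_le_mul_of_nonneg_left (tsirelsonNorm_filter_le θ _ x) hε.le
  have n₃ : ε * tsirelsonNorm θ x₃ ≤ ε * tsirelsonNorm θ x :=
    mul_le_mul_of_nonneg_left (tsirelsonNorm_filter_le θ _ x) hε.le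
  have a₁ := abs_le.1 ((abs_le_of_sum_le θ hm s₁).trans n₁)
  have a₂ := abs_le.1 ((abs_le_of_sum_le θ hn s₁).trans n₁)
  have b₁ := abs_le.1 (abs_toC00Dual_le_of_norm_le (hF m) x₂)
  have b₂ := abs_le.1 ((abs_le_of_sum_le θ hn' fun i hi => (s₂ i hi).2).trans n₂)
  have b₃ := abs_le.1 ((hM₁ x₂ fun i hi => by have := (s₂ i hi).1; omega).trans n₂)
  have c₁ := abs_le.1 ((hM₂ x₃ fun i hi => by have := s₃ i hi; omega).trans n₃)
  have c₂ := abs_le.1 (abs_toC00Dual_le_of_norm_le (hF n) x₃)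
  have hsum := tsirelsonNorm_filter_add_filter_le θ x (M := M) (M' := M') (by omega) (by omega)
  rw [← hx₂, ← hx₃] at hsum
  have hrhs : (1 / θ + 5 * ε) * tsirelsonNorm θ x =
    tsirelsonNorm θ x / θ + 5 * (ε * tsirelsonNorm θ x) := by ring
  rw [hrhs]
  simp only [map_sub, LinearMap.sub_apply] at a₁ a₂ b₂ ⊢
  rw [hx]
  simp only [map_add]
  rw [← hx]
  rw [abs_le]
  constructor <;> linarith

/-- The coordinate functionals lie in the dual ball. -/
lemma exists_coordinate_functionals (θ : Set.Ioo (0 : ℝ) 1) :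
    ∃ F : ℕ → OriginalTsirelsonSpace θ, (∀ n, ‖F n‖ ≤ 1) ∧
      ∀ n x, toC00Dual (F n) x = x n.succPNat := by
  have h : ∀ n : ℕ, ∃ F : OriginalTsirelsonSpace θ, ‖F‖ ≤ 1 ∧
      toC00Dual F = Finsupp.lapply n.succPNat := fun n =>
    exists_toC00Dual_eq zero_le_one fun x => by
      rw [one_mul]
      exact abs_le_tsirelsonNorm θ x _
  choose F hF hF' using h
  exact ⟨F, hF, fun n x => by rw [hF']; rfl⟩

/-- Evaluation at `e_m + s e_n` gives `1 + s² = 2`. -/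
lemma le_norm_add_smul_of_coordinate {F G : OriginalTsirelsonSpace θ} {m n : ℕ+} (hmn : m ≠ n)
    (hF : ∀ x, toC00Dual F x = x m) (hG : ∀ x, toC00Dual G x = x n) {s : ℝ} (hs : |s| = 1) :
    2 / max 1 (2 * (θ : ℝ)) ≤ ‖F + s • G‖ := by
  have hpos : (0 : ℝ) < max 1 (2 * (θ : ℝ)) := lt_max_of_lt_left one_pos
  set x : C00 := Finsupp.single m 1 + Finsupp.single n s
  have hx : tsirelsonNorm θ x ≤ max 1 (2 * (θ : ℝ)) :=
    tsirelsonNorm_single_add_single_le θ hmn (by simp) hs.le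
  have hval : toC00Dual (F + s • G) x = 2 := by
    have hss : s * s = 1 := by rw [← abs_mul_abs_self, hs, one_mul]
    simp only [map_add, map_smul, LinearMap.add_apply, LinearMap.smul_apply, hF, hG]
    simp [x, hmn, hmn.symm, hss]
    norm_num
  have h := abs_toC00Dual_le (F + s • G) x
  rw [hval, abs_two] at h
  rw [div_le_iff₀ hpos]
  exact h.trans (mul_le_mul_of_nonneg_left hx (norm_nonneg _))

end Separation

end Tsirelson

/-! ### Bounds for the separation constants, and the theorem -/

lemma symmetricKottmanConstant_le_kottmanConstant (X : Type*) [NormedAddCommGroup X] :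
    symmetricKottmanConstant X ≤ kottmanConstant X := by
  refine csSup_le_csSup ⟨2, ?_⟩ ⟨0, le_rfl, 0, by simp, by simp⟩ ?_
  · rintro σ ⟨-, x, hx, hσ⟩
    linarith [hσ 0 1 zero_ne_one, norm_sub_le (x 0) (x 1), hx 0, hx 1]
  · rintro σ ⟨h0, x, hx, hσ⟩
    exact ⟨h0, x, hx, fun m n h => (hσ m n h).1⟩

lemma le_symmetricKottmanConstant {X : Type*} [NormedAddCommGroup X] {σ : ℝ} (h0 : 0 ≤ σ)
    {x : ℕ → X} (hx : ∀ n, ‖x n‖ ≤ 1)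
    (h : ∀ m n, m ≠ n → σ ≤ ‖x m - x n‖ ∧ σ ≤ ‖x m + x n‖) : σ ≤ symmetricKottmanConstant X := by
  refine le_csSup ⟨2, ?_⟩ ⟨h0, x, hx, h⟩
  rintro σ ⟨-, x, hx, hσ⟩
  linarith [(hσ 0 1 zero_ne_one).1, norm_sub_le (x 0) (x 1), hx 0, hx 1]

lemma kottmanConstant_le {X : Type*} [NormedAddCommGroup X] {C : ℝ}
    (h : ∀ x : ℕ → X, (∀ n, ‖x n‖ ≤ 1) → ∀ ε > 0, ∃ m n, m ≠ n ∧ ‖x m - x n‖ ≤ C + ε) :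
    kottmanConstant X ≤ C := by
  refine csSup_le ⟨0, le_rfl, 0, by simp, by simp⟩ ?_
  rintro σ ⟨-, x, hx, hσ⟩
  refine le_of_forall_pos_le_add fun ε hε => ?_
  obtain ⟨m, n, hmn, hle⟩ := h x hx ε hε
  exact (hσ m n hmn).trans hle

theorem mainTheorem3 (θ : ℝ) (hθ : θ ∈ Set.Ioo (0 : ℝ) 1) :
    kottmanConstant (OriginalTsirelsonSpace ⟨θ, hθ⟩) =
        symmetricKottmanConstant (OriginalTsirelsonSpace ⟨θ, hθ⟩) ∧
      symmetricKottmanConstant (OriginalTsirelsonSpace ⟨θ, hθ⟩) =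
        if θ ≤ 1 / 2 then 2 else 1 / θ := by
  have hval : (2 : ℝ) / max 1 (2 * θ) = if θ ≤ 1 / 2 then 2 else 1 / θ := by
    split_ifs with h
    · rw [max_eq_left (by linarith), div_one]
    · rw [max_eq_right (by linarith), ← div_div, div_self two_ne_zero]
  have hle := symmetricKottmanConstant_le_kottmanConstant (OriginalTsirelsonSpace ⟨θ, hθ⟩)
  have hlower : 2 / max 1 (2 * θ) ≤ symmetricKottmanConstant (OriginalTsirelsonSpace ⟨θ, hθ⟩) := by
    obtain ⟨F, hF, hF'⟩ := Tsirelson.exists_coordinate_functionals ⟨θ, hθ⟩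
    refine le_symmetricKottmanConstant (by positivity) hF fun m n hmn => ?_
    have hne : m.succPNat ≠ n.succPNat := fun h => hmn (Nat.succPNat_injective h)
    have h1 := Tsirelson.le_norm_add_smul_of_coordinate hne (hF' m) (hF' n) (s := 1) (by simp)
    have h2 := Tsirelson.le_norm_add_smul_of_coordinate hne (hF' m) (hF' n) (s := -1) (by simp)
    rw [one_smul] at h1
    have h3 : F m + (-1 : ℝ) • F n = F m - F n :=
      ContinuousLinearMap.ext fun x => by simp [sub_eq_add_neg]
    rw [h3] at h2
    exact ⟨h2, h1⟩
  have hupper : kottmanConstant (OriginalTsirelsonSpace ⟨θ, hθ⟩) ≤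
      if θ ≤ 1 / 2 then 2 else 1 / θ := by
    refine kottmanConstant_le fun F hF ε hε => ?_
    split_ifs
    · exact ⟨0, 1, zero_ne_one, by linarith [norm_sub_le (F 0) (F 1), hF 0, hF 1]⟩
    -- The five error terms add up to `ε`.
    · obtain ⟨m, n, hmn, h⟩ := Tsirelson.exists_norm_sub_le hF (ε := ε / 5) (by positivity)
      exact ⟨m, n, hmn, h.trans_eq (by ring)⟩
  rw [hval] at hlower
  exact ⟨le_antisymm (hupper.trans hlower) hle, le_antisymm (hle.trans hupper) hlower⟩
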